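/- For a finite group $G$ with centre $Z(G)$, let $\Gamma_G$ be the commuting graph: its vertex set is $G\setminus Z(G)$, and two distinct vertices $x,y$ are adjacent if and only if $xy=yx$. For a finite graph $\Gamma$, let $\mathcal{E}(\Gamma)$ be its energy, the sum of the absolute values of the eigenvalues of its adjacency matrix, counted with multiplicity. 1. Let $n\ge 4$ and $QD_{2^n}=\langle a,b \mid a^{2^{n-1}}=b^2=1,\ bab^{-1}=a^{2^{n-2}-1}\rangle$. Then $$\mathcal{E}(\Gamma_{QD_{2^n}})=2^n+2^{n-1}-6.$$ 2. Let $k\ge 2$. Then $$\mathcal{E}(\Gamma_{PSL(2,2^k)})=(2^{3k}-2^{2k}-2^{k+1}-2)+(2^k-1)\,2^{k-1}(2^k-1)+(2^k-2)(2^k+1)+(2^k-3)\,2^{k-1}(2^k+1).$$ 3. Let $q=p^n>2$ with $p$ prime. Then $$\mathcal{E}(\Gamma_{GL(2,q)})=(q^4-q^3-2q^2-q)+(q^2-3q+1)\frac{q(q+1)}{2}+(q^2-q-1)\frac{q(q-1)}{2}+(q^2-2q)(q+1).$$ 4. Let $G$ be a finite group with $G/Z(G)\cong Sz(2)=\langle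 a,b\mid a^5=b^4=1,\ b^{-1}ab=a^2\rangle$. Then $$\mathcal{E}(\Gamma_G)=38\,|Z(G)|-12.$$ 5. Let $n\ge 2$, let $F=GF(2^n)$, let $\vartheta(x)=x^2$ be the Frobenius automorphism of $F$, and let $A(n,\vartheta)$ be the group, under matrix multiplication, of all matrices $\begin{bmatrix}1&0&0\\ a&1&0\\ b&\vartheta(a)&1\end{bmatrix}$ with $a,b\in F$. Then $$\mathcal{E}(\Gamma_{A(n,\vartheta)})=2(2^n-1)^2.$$ 6. Let $p$ be a prime, let $n\ge 1$, let $F=GF(p^n)$, and let $A(n,p)$ be the group, under matrix multiplication, of all matrices $\begin{bmatrix}1&0&0\\ a&1&0\\ b&c&1\end{bmatrix}$ with $a,b,c\in F$. Then $$\mathcal{E}(\Gamma_{A(n,p)})=2p^{3n}-4p^n-2.$$ 7. Let $G$ be a non-Abelian group of order $pq$, where $p$ and $q$ are primes with $p\mid q-1$. Then $$\mathcal{E}(\Gamma_G)=2q(p-1)-4.$$ -/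

import Mathlib

/-- The commuting graph of a group `G`: its vertices are the non-central elements of `G`, and two
distinct vertices are adjacent exactly when they commute. -/
def commutingGraph (G : Type*) [Group G] : SimpleGraph {x : G // x ∉ Subgroup.center G} where
  Adj x y := x ≠ y ∧ (x : G) * y = y * x
  symm := ⟨fun _ _ h => ⟨h.1.symm, h.2.symm⟩⟩
  loopless := ⟨fun _ h => h.1 rfl⟩

open Classical in
/-- The spectrum of a finite graph: the multiset of eigenvalues of its (real symmetric) adjacency
matrix, each one repeated according to its multiplicity. -/
noncomputable def graphSpectrum {V : Type*} [Finite V] (Γ : SimpleGraph V) : Multiset ℝ :=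
  letI : Fintype V := Fintype.ofFinite V
  (Γ.adjMatrix ℝ).charpoly.roots

/-- The energy of a finite graph: the sum of the absolute values of its eigenvalues, counted with
multiplicity. -/
noncomputable def graphEnergy {V : Type*} [Finite V] (Γ : SimpleGraph V) : ℝ :=
  ((graphSpectrum Γ).map (fun t => |t|)).sum

/-- The relators of `⟨a, b | a ^ (2 ^ (n - 1)) = b ^ 2 = 1, b a b⁻¹ = a ^ (2 ^ (n - 2) - 1)⟩`,
where `a` is the generator `0` and `b` is the generator `1`. -/
def quasidihedralRels (n : ℕ) : Set (FreeGroup (Fin 2)) :=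
  {FreeGroup.of 0 ^ (2 ^ (n - 1)),
   FreeGroup.of 1 ^ 2,
   FreeGroup.of 1 * FreeGroup.of 0 * (FreeGroup.of 1)⁻¹ *
     (FreeGroup.of 0 ^ (2 ^ (n - 2) - 1))⁻¹}

/-- The quasidihedral group of order `2 ^ n` (for `4 ≤ n`), by its presentation. -/
abbrev QuasidihedralGroup (n : ℕ) : Type := PresentedGroup (quasidihedralRels n)

/-- The quasidihedral group is finite: every element has the form `a ^ i * b ^ j`. -/
instance quasidihedralGroup_finite (n : ℕ) : Finite (QuasidihedralGroup n) := by
  set a : QuasidihedralGroup n := PresentedGroup.of 0 with ha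
  set b : QuasidihedralGroup n := PresentedGroup.of 1 with hb
  set k := 2 ^ (n - 2) - 1 with hk
  have h1 : a ^ (2 ^ (n - 1)) = 1 :=
    PresentedGroup.one_of_mem (rels := quasidihedralRels n) (by simp [quasidihedralRels])
  have h2 : b ^ 2 = 1 :=
    PresentedGroup.one_of_mem (rels := quasidihedralRels n)
      (x := FreeGroup.of 1 ^ 2) (by simp [quasidihedralRels])
  have h3 : b * a * b⁻¹ * (a ^ k)⁻¹ = 1 :=
    PresentedGroup.one_of_mem (rels := quasidihedralRels n)
      (x := FreeGroup.of 1 * FreeGroup.of 0 * (FreeGroup.of 1)⁻¹ *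
        (FreeGroup.of 0 ^ (2 ^ (n - 2) - 1))⁻¹) (by simp [quasidihedralRels])
  have h4 : b * a * b⁻¹ = a ^ k := mul_inv_eq_one.mp h3
  have h5 (i : ℕ) : b * a ^ i = a ^ (k * i) * b := by
    rw [pow_mul, ← h4, conj_pow]; group
  have hfa : IsOfFinOrder a := isOfFinOrder_iff_pow_eq_one.mpr ⟨_, by positivity, h1⟩
  have hfb : IsOfFinOrder b := isOfFinOrder_iff_pow_eq_one.mpr ⟨2, by norm_num, h2⟩
  let S : Set (QuasidihedralGroup n) :=
    Set.image2 (fun x y => x * y) (Submonoid.powers a) (Submonoid.powers b)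
  have hS : S.Finite :=
    (finite_powers.mpr hfa).image2 _ (finite_powers.mpr hfb)
  have key : ∀ x : QuasidihedralGroup n, x ∈ S := by
    have hA (y : QuasidihedralGroup n) (hy : y ∈ S) (m : ℕ) : a ^ m * y ∈ S := by
      obtain ⟨_, ⟨i, rfl⟩, _, ⟨j, rfl⟩, rfl⟩ := hy
      exact ⟨a ^ (m + i), ⟨m + i, rfl⟩, b ^ j, ⟨j, rfl⟩, by simp [pow_add, mul_assoc]⟩
    have hB (y : QuasidihedralGroup n) (hy : y ∈ S) : b * y ∈ S := by
      obtain ⟨_, ⟨i, rfl⟩, _, ⟨j, rfl⟩, rfl⟩ := hy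
      refine ⟨a ^ (k * i), ⟨k * i, rfl⟩, b ^ (1 + j), ⟨1 + j, rfl⟩, ?_⟩
      simp only [pow_add, pow_one, ← mul_assoc, h5]
    have hai : a⁻¹ = a ^ (2 ^ (n - 1) - 1) := by
      rw [inv_eq_iff_mul_eq_one, ← pow_succ', Nat.sub_add_cancel Nat.one_le_two_pow, h1]
    have hbi : b⁻¹ = b := by rw [inv_eq_iff_mul_eq_one, ← pow_two, h2]
    have hgen (i : Fin 2) : (PresentedGroup.of i : QuasidihedralGroup n) = a ∨
        (PresentedGroup.of i : QuasidihedralGroup n) = b := by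
      fin_cases i
      · exact Or.inl rfl
      · exact Or.inr rfl
    intro x
    have hx : x ∈ Subgroup.closure
        (Set.range (PresentedGroup.of (rels := quasidihedralRels n))) := by
      rw [PresentedGroup.closure_range_of]; trivial
    induction hx using Subgroup.closure_induction_left with
    | one => exact ⟨1, one_mem _, 1, one_mem _, by simp⟩
    | mul_left g hg y _ ih =>
      obtain ⟨i, rfl⟩ := hg
      rcases hgen i with h | h <;> rw [h]
      · simpa using hA y ih 1
      · exact hB y ih
    | inv_mul_cancel g hg y _ ih =>
      obtain ⟨i, rfl⟩ := hg
      rcases hgen i with h | h <;> rw [h]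
      · rw [hai]; exact hA y ih _
      · rw [hbi]; exact hB y ih
  exact Set.finite_univ_iff.mp (hS.subset fun x _ => key x)

/-- The relators of `⟨a, b | a ^ 5 = b ^ 4 = 1, b⁻¹ a b = a ^ 2⟩`, where `a` is the generator `0`
and `b` is the generator `1`. -/
def suzukiTwoRels : Set (FreeGroup (Fin 2)) :=
  {FreeGroup.of 0 ^ 5,
   FreeGroup.of 1 ^ 4,
   (FreeGroup.of 1)⁻¹ * FreeGroup.of 0 * FreeGroup.of 1 * (FreeGroup.of 0 ^ 2)⁻¹}

/-- The group `Sz(2)`, by its presentation. -/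
abbrev SuzukiTwo : Type := PresentedGroup suzukiTwoRels

/-- The group of the matrices `U(a, b)` with rows `(1, 0, 0)`, `(a, 1, 0)`, `(b, θ a, 1)` under
matrix multiplication, for an automorphism `θ` of the field `F`. -/
def groupATheta {F : Type*} [Field F] (θ : F ≃+* F) :
    Subgroup (Matrix.SpecialLinearGroup (Fin 3) F) where
  carrier := {M | ∃ a b : F, (M : Matrix (Fin 3) (Fin 3) F) = !![1, 0, 0; a, 1, 0; b, θ a, 1]}
  mul_mem' := by
    rintro M N ⟨a, b, hM⟩ ⟨a', b', hN⟩
    refine ⟨a + a', b + θ a * a' + b', ?_⟩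
    rw [Matrix.SpecialLinearGroup.coe_mul, hM, hN]
    ext i j
    fin_cases i <;> fin_cases j <;> simp [Matrix.mul_apply, Fin.sum_univ_three]
  one_mem' := by
    refine ⟨0, 0, ?_⟩
    ext i j
    fin_cases i <;> fin_cases j <;> simp
  inv_mem' := by
    rintro M ⟨a, b, hM⟩
    refine ⟨-a, -b + a * θ a, ?_⟩
    rw [Matrix.SpecialLinearGroup.coe_inv, hM, Matrix.adjugate_fin_three]
    ext i j
    fin_cases i <;> fin_cases j <;> first | (simp; done) | (simp; ring)

/-- The group of the matrices `V(a, b, c)` with rows `(1, 0, 0)`, `(a, 1, 0)`, `(b, c, 1)` under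
matrix multiplication, that is, the lower unitriangular `3 × 3` matrices over `F`. -/
def groupAP (F : Type*) [Field F] : Subgroup (Matrix.SpecialLinearGroup (Fin 3) F) where
  carrier := {M | ∃ a b c : F, (M : Matrix (Fin 3) (Fin 3) F) = !![1, 0, 0; a, 1, 0; b, c, 1]}
  mul_mem' := by
    rintro M N ⟨a, b, c, hM⟩ ⟨a', b', c', hN⟩
    refine ⟨a + a', b + c * a' + b', c + c', ?_⟩
    rw [Matrix.SpecialLinearGroup.coe_mul, hM, hN]
    ext i j
    fin_cases i <;> fin_cases j <;> simp [Matrix.mul_apply, Fin.sum_univ_three]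
  one_mem' := by
    refine ⟨0, 0, 0, ?_⟩
    ext i j
    fin_cases i <;> fin_cases j <;> simp
  inv_mem' := by
    rintro M ⟨a, b, c, hM⟩
    refine ⟨-a, -b + a * c, -c, ?_⟩
    rw [Matrix.SpecialLinearGroup.coe_inv, hM, Matrix.adjugate_fin_three]
    ext i j
    fin_cases i <;> fin_cases j <;> first | (simp; done) | (simp; ring)

/-!
All the groups considered share one feature: the centralizer of a non-central element is abelian, so
commuting is an equivalence relation on `G \ Z(G)` and the commuting graph is a disjoint union of
cliques. The adjacency matrix of a disjoint union of `c` cliques on `N` vertices is `P * Pᵀ - 1`,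
where `P` is the incidence matrix of vertices and cliques. As `Pᵀ * P` is diagonal with the sizes
`m i` of the cliques as entries, the eigenvalues are `-1`, with multiplicity `N - c`, and the numbers
`m i - 1`. So the energy is `2 * (N - c)`, whatever the individual sizes are
(`graphEnergy_of_adj_iff`), and `N = |G| - |Z(G)|` (`graphEnergy_commutingGraph`). What remains is to
name the set of cliques of each group and count it.

* Two `2 × 2` matrices commute iff their classes modulo scalars are proportional
  (`mul_comm_iff_coordsModScalars`). So the cliques of `GL(2, q)`, and of `SL(2, q) ≅ PSL(2, q)` for
  even `q`, are the `q ^ 2 + q + 1` points of a projective plane.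
* In the unitriangular group the cliques are the points of the projective line of the pairs `(a, c)`;
  in `A(n, θ)` they are the nonzero values of `a`.
* In a non-Abelian group of order `p * q` a nontrivial element generates its centralizer
  (`zpowers_eq_centralizer`), so the cliques are the `q` Sylow `p`-subgroups and the Sylow
  `q`-subgroup.
* The presented groups are identified with groups of affine maps `x ↦ u * x + t` over `ℤ / m`
  (`injective_of_metacyclic`); two such maps commute iff `(u - 1) * t' = (u' - 1) * t`. For `Sz(2)`,
  the full affine group of `ℤ / 5`, commuting elements are powers of a common element
  (`AffineGroup.exists_pow_eq_of_commute`), so commuting in `G` can be read off from `G / Z(G)`, and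
  the cliques are the six points of a projective line. For the quasidihedral group they are the
  non-central rotations and the pairs `{a ^ i * b, a ^ (i + 2 ^ (n - 2)) * b}`.
-/

/-! ### Energy of a disjoint union of cliques -/

open Polynomial in
/-- If adjacency means having the same label under a surjective labelling `f : V → ι`, then the
graph is a disjoint union of `|ι|` cliques and each clique `K_m` contributes `2 * (m - 1)`. -/
theorem graphEnergy_of_adj_iff {V ι : Type*} [Finite V] (Γ : SimpleGraph V) (f : V → ι)
    (hf : Function.Surjective f) (h : ∀ x y, Γ.Adj x y ↔ x ≠ y ∧ f x = f y) :
    graphEnergy Γ = 2 * ((Nat.card V : ℝ) - Nat.card ι) := by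
  classical
  let _ : Fintype V := Fintype.ofFinite V
  let _ : Fintype ι := @Fintype.ofFinite ι (Finite.of_surjective f hf)
  have hle : Fintype.card ι ≤ Fintype.card V := Fintype.card_le_of_surjective f hf
  -- `P` is the incidence matrix of vertices and labels: `P * Pᵀ` is the adjacency matrix plus the
  -- identity, while `Pᵀ * P` is diagonal and records the sizes of the cliques.
  let P : Matrix V ι ℝ := Matrix.of fun v i => if f v = i then 1 else 0
  let m : ι → ℕ := fun i => (Finset.univ.filter fun v => f v = i).card
  have hA : Γ.adjMatrix ℝ = P * P.transpose - Matrix.scalar V 1 := by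
    ext x y
    by_cases hxy : x = y
    · subst hxy; simp [P, Matrix.mul_apply]
    · by_cases hfxy : f x = f y <;> simp [P, Matrix.mul_apply, h, hxy, hfxy, eq_comm]
  have hD : P.transpose * P = Matrix.diagonal fun i => (m i : ℝ) := by
    ext i j
    by_cases hij : i = j
    · subst hij; simp [P, m, Matrix.mul_apply, ← ite_and]
    · rw [Matrix.diagonal_apply_ne _ hij, Matrix.mul_apply]
      refine Finset.sum_eq_zero fun v _ => ?_
      by_cases hv : f v = i
      · simp [P, hv, hij]
      · simp [P, hv]
  have hroots : (P * P.transpose).charpoly.roots =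
      Multiset.replicate (Fintype.card V - Fintype.card ι) 0 +
        Finset.univ.val.map fun i => (m i : ℝ) := by
    rw [Matrix.charpoly_mul_comm_of_le _ _ hle, hD, Matrix.charpoly_diagonal, roots_mul,
      roots_X_pow, Multiset.nsmul_singleton]
    · congr 1
      exact roots_multiset_prod_X_sub_C (Finset.univ.val.map fun i => (m i : ℝ)) ▸ by simp
    · exact mul_ne_zero (pow_ne_zero _ X_ne_zero)
        (Finset.prod_ne_zero_iff.mpr fun i _ => X_sub_C_ne_zero _)
  have hspec : graphSpectrum Γ = (P * P.transpose).charpoly.roots.map fun t => t - 1 := by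
    have h1 := roots_comp_C_mul_X_add_C (P * P.transpose).charpoly 1 1 isUnit_one
    simp only [C_1, one_mul, Ring.inverse_one] at h1
    unfold graphSpectrum
    have h2 : (Γ.adjMatrix ℝ).charpoly.roots =
        (P * P.transpose).charpoly.roots.map fun t => t - 1 := by
      rw [hA, Matrix.charpoly_sub_scalar, C_1, h1]
    exact h2
  have hm (i : ι) : |(m i : ℝ) - 1| = m i - 1 := by
    obtain ⟨v, hv⟩ := hf i
    have : 1 ≤ m i := Finset.card_pos.mpr ⟨v, by simp [hv]⟩
    exact abs_of_nonneg (sub_nonneg.mpr (by exact_mod_cast this))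
  have hsum : ∑ i, (m i : ℝ) = Fintype.card V := by
    rw [← Nat.cast_sum]
    congr 1
    exact (Finset.card_eq_sum_card_fiberwise fun x _ => Finset.mem_univ (f x)).symm
  have hE : graphEnergy Γ = ((Fintype.card V - Fintype.card ι : ℕ) : ℝ) +
      ∑ i, ((m i : ℝ) - 1) := by
    simp [graphEnergy, hspec, hroots, hm]
  rw [hE, Finset.sum_sub_distrib, hsum, Nat.cast_sub hle, Nat.card_eq_fintype_card,
    Nat.card_eq_fintype_card]
  simp
  ring

/-- If commuting of non-central elements is the kernel of a surjection onto `ι`, then the commuting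
graph is a disjoint union of `|ι|` cliques on `|G| - |Z(G)|` vertices. -/
theorem graphEnergy_commutingGraph {G ι : Type*} [Group G] [Finite G]
    (f : {x : G // x ∉ Subgroup.center G} → ι) (hf : Function.Surjective f)
    (h : ∀ x y : {x : G // x ∉ Subgroup.center G}, (x : G) * y = y * x ↔ f x = f y) :
    graphEnergy (commutingGraph G) =
      2 * ((Nat.card G : ℝ) - Nat.card (Subgroup.center G) - Nat.card ι) := by
  rw [graphEnergy_of_adj_iff _ f hf fun x y => and_congr_right fun _ => h x y]
  have : Nat.card {x : G // x ∉ Subgroup.center G} + Nat.card (Subgroup.center G) = Nat.card G := by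
    classical
    rw [add_comm, ← Nat.card_sum]
    exact Nat.card_congr (Equiv.sumCompl (· ∈ Subgroup.center G))
  rw [← this]
  push_cast
  ring

theorem graphEnergy_congr {V W : Type*} [Finite V] [Finite W] {Γ : SimpleGraph V}
    {Δ : SimpleGraph W} (e : Γ ≃g Δ) : graphEnergy Γ = graphEnergy Δ := by
  classical
  let _ : Fintype V := Fintype.ofFinite V
  let _ : Fintype W := Fintype.ofFinite W
  have h : (Γ.adjMatrix ℝ).charpoly = (Δ.adjMatrix ℝ).charpoly := by
    rw [← Matrix.charpoly_reindex e.toEquiv (Γ.adjMatrix ℝ)]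
    congr 1
    ext x y
    have := e.symm.map_adj_iff (v := x) (w := y)
    simp only [Matrix.reindex_apply, Matrix.submatrix_apply, SimpleGraph.adjMatrix_apply]
    exact if_congr this rfl rfl
  unfold graphEnergy graphSpectrum
  rw [h]

/-- Isomorphic groups have isomorphic commuting graphs, hence the same energy. -/
theorem graphEnergy_commutingGraph_congr {G H : Type*} [Group G] [Group H] [Finite G] [Finite H]
    (e : G ≃* H) : graphEnergy (commutingGraph G) = graphEnergy (commutingGraph H) := by
  have hc (x : G) : x ∉ Subgroup.center G ↔ e x ∉ Subgroup.center H := by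
    rw [not_iff_not, Subgroup.mem_center_iff, Subgroup.mem_center_iff, e.surjective.forall]
    simp only [← map_mul, e.injective.eq_iff]
  refine graphEnergy_congr ⟨e.toEquiv.subtypeEquiv hc, @fun x y => ?_⟩
  simp only [commutingGraph, Equiv.subtypeEquiv_apply, ne_eq,
    EmbeddingLike.apply_eq_iff_eq, MulEquiv.toEquiv_eq_coe, MulEquiv.coe_toEquiv, ← map_mul,
    Subtype.ext_iff]

/-! ### Proportional vectors and commuting matrices -/

/-- Two nonzero vectors span the same line iff all their `2 × 2` minors vanish. -/
theorem projectivization_mk_eq_mk_iff_minors {F : Type*} [Field F] {n : ℕ} {v w : Fin n → F}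
    (hv : v ≠ 0) (hw : w ≠ 0) :
    Projectivization.mk F v hv = Projectivization.mk F w hw ↔ ∀ i j, v i * w j = v j * w i := by
  rw [Projectivization.mk_eq_mk_iff']
  constructor
  · rintro ⟨a, rfl⟩ i j
    simp only [Pi.smul_apply, smul_eq_mul]
    ring
  · intro h
    obtain ⟨j, hj⟩ := Function.ne_iff.mp hw
    refine ⟨v j / w j, funext fun i => ?_⟩
    simp only [Pi.zero_apply] at hj
    simp only [Pi.smul_apply, smul_eq_mul]
    rw [div_mul_eq_mul_div, div_eq_iff hj, h i j]

section Matrices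

variable {F : Type*} [Field F]

/-- Coordinates of a `2 × 2` matrix modulo the scalar matrices. -/
def coordsModScalars (M : Matrix (Fin 2) (Fin 2) F) : Fin 3 → F :=
  ![M 0 1, M 1 0, M 0 0 - M 1 1]

theorem coordsModScalars_eq_zero {M : Matrix (Fin 2) (Fin 2) F} :
    coordsModScalars M = 0 ↔ M ∈ Set.range (Matrix.scalar (Fin 2)) := by
  constructor
  · intro h
    have h0 : M 0 1 = 0 := congrFun h 0
    have h1 : M 1 0 = 0 := congrFun h 1
    have h2 : M 0 0 - M 1 1 = 0 := congrFun h 2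
    refine ⟨M 1 1, ?_⟩
    ext i j
    fin_cases i <;> fin_cases j <;> simp [h0, h1, sub_eq_zero.mp h2]
  · rintro ⟨a, rfl⟩
    ext i
    fin_cases i <;> simp [coordsModScalars]

/-- The commutator of two `2 × 2` matrices is, up to signs, the cross product of their coordinates
modulo scalars. -/
theorem mul_comm_iff_coordsModScalars (M N : Matrix (Fin 2) (Fin 2) F) :
    M * N = N * M ↔ ∀ i j, coordsModScalars M i * coordsModScalars N j =
      coordsModScalars M j * coordsModScalars N i := by
  simp only [← Matrix.ext_iff, Matrix.mul_apply, Fin.sum_univ_two, Fin.forall_fin_two,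
    coordsModScalars]
  constructor
  · rintro ⟨⟨h1, h2⟩, h3, h4⟩ i j
    fin_cases i <;> fin_cases j <;> simp <;> grind
  · intro h
    have h1 := h 0 1
    have h2 := h 0 2
    have h3 := h 1 2
    simp at h1 h2 h3
    refine ⟨⟨?_, ?_⟩, ?_, ?_⟩
    · linear_combination h1
    · linear_combination -h2
    · linear_combination h3
    · linear_combination -h1

/-- Every vector is the vector of coordinates modulo scalars of an invertible matrix, as soon as `F`
has three elements: adding a scalar avoids the at most two roots of the determinant. -/
theorem exists_coordsModScalars_eq [Finite F] (hF : 2 < Nat.card F) (v : Fin 3 → F) :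
    ∃ M : Matrix (Fin 2) (Fin 2) F, M.det ≠ 0 ∧ coordsModScalars M = v := by
  classical
  let _ : Fintype F := Fintype.ofFinite F
  let p : Polynomial F := .C 1 * .X ^ 2 + .C (v 2) * .X + .C (-(v 0 * v 1))
  have hp : p.natDegree = 2 := Polynomial.natDegree_quadratic one_ne_zero
  obtain ⟨t, ht⟩ : ∃ t, t ∉ p.roots.toFinset := by
    by_contra! h
    have h1 : Fintype.card F ≤ p.roots.toFinset.card := Finset.card_le_card fun t _ => h t
    have h2 := (Multiset.toFinset_card_le p.roots).trans p.card_roots'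
    rw [Nat.card_eq_fintype_card] at hF
    omega
  have hp0 : p ≠ 0 := fun h => by simp [h] at hp
  refine ⟨!![t + v 2, v 0; v 1, t], fun h => ht ?_, ?_⟩
  · rw [Multiset.mem_toFinset, Polynomial.mem_roots hp0, Polynomial.IsRoot.def, ← h]
    simp [p, Matrix.det_fin_two]
    ring
  · ext i
    fin_cases i <;> simp [coordsModScalars]

theorem card_projectivization_fin [Finite F] (n : ℕ) :
    Nat.card (Projectivization F (Fin n → F)) = ∑ i ∈ Finset.range n, Nat.card F ^ i :=
  Projectivization.card_of_finrank F _ (by simp)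

/-! ### General and special linear groups of degree two -/

theorem card_GL_two [Finite F] : (Nat.card (Matrix.GeneralLinearGroup (Fin 2) F) : ℝ) =
    ((Nat.card F : ℝ) ^ 2 - 1) * ((Nat.card F : ℝ) ^ 2 - Nat.card F) := by
  let _ : Fintype F := Fintype.ofFinite F
  have h : 1 ≤ Nat.card F := Nat.card_pos
  rw [Matrix.card_GL_field, Fin.prod_univ_two, ← Nat.card_eq_fintype_card]
  simp only [Fin.val_zero, Fin.val_one, pow_zero, pow_one]
  rw [Nat.cast_mul, Nat.cast_sub (Nat.one_le_pow _ _ h),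
    Nat.cast_sub (Nat.le_self_pow two_ne_zero _)]
  simp

theorem card_center_GL_two [Finite F] :
    (Nat.card (Subgroup.center (Matrix.GeneralLinearGroup (Fin 2) F)) : ℝ) = Nat.card F - 1 := by
  have hinj : Function.Injective
      (Matrix.GeneralLinearGroup.scalar (Fin 2) : Fˣ →* Matrix.GeneralLinearGroup (Fin 2) F) := by
    intro u v h
    have := (Matrix.GeneralLinearGroup.ext_iff _ _).mp h 0 0
    exact Units.ext (by simpa using this)
  rw [Matrix.GeneralLinearGroup.center_eq_range_scalar,
    ← Nat.card_congr (MonoidHom.ofInjective hinj).toEquiv, Nat.card_units,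
    Nat.cast_sub Nat.card_pos, Nat.cast_one]

theorem card_SL_two [Finite F] : (Nat.card (Matrix.SpecialLinearGroup (Fin 2) F) : ℝ) =
    (Nat.card F : ℝ) * ((Nat.card F : ℝ) ^ 2 - 1) := by
  have hcard := (Matrix.GeneralLinearGroup.det :
    Matrix.GeneralLinearGroup (Fin 2) F →* Fˣ).ker.card_mul_index
  have hsurj : Function.Surjective
      (Matrix.GeneralLinearGroup.det : Matrix.GeneralLinearGroup (Fin 2) F →* Fˣ) :=
    Matrix.GeneralLinearGroup.det_surjective
  rw [Subgroup.index_ker, MonoidHom.range_eq_top.mpr hsurj, Subgroup.card_top,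
    Nat.card_units] at hcard
  have hker : Nat.card (Matrix.GeneralLinearGroup.det :
      Matrix.GeneralLinearGroup (Fin 2) F →* Fˣ).ker =
      Nat.card (Matrix.SpecialLinearGroup (Fin 2) F) := by
    have hmem (g : Matrix.SpecialLinearGroup (Fin 2) F) :
        g.toGL ∈ (Matrix.GeneralLinearGroup.det :
          Matrix.GeneralLinearGroup (Fin 2) F →* Fˣ).ker := by
      rw [MonoidHom.mem_ker, Matrix.SpecialLinearGroup.coeToGL_det]
    refine (Nat.card_congr (Equiv.ofBijective (fun g => ⟨g.toGL, hmem g⟩) ⟨?_, ?_⟩)).symm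
    · intro g h hgh
      exact Matrix.SpecialLinearGroup.toGL_injective (congrArg Subtype.val hgh)
    · rintro ⟨g, hg⟩
      refine ⟨⟨g.val, congrArg Units.val hg⟩, Subtype.ext (Units.ext rfl)⟩
  have h1 : (1 : ℝ) < Nat.card F := by exact_mod_cast Finite.one_lt_card
  have h2 := congrArg (Nat.cast : ℕ → ℝ) hcard
  rw [hker, card_GL_two, Nat.cast_mul, Nat.cast_sub Nat.card_pos, Nat.cast_one] at h2
  have h3 : (Nat.card F : ℝ) - 1 ≠ 0 := by linarith
  apply mul_right_cancel₀ h3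
  rw [h2]
  ring

theorem graphEnergy_commutingGraph_GL_two [Finite F] (hF : 2 < Nat.card F) :
    graphEnergy (commutingGraph (Matrix.GeneralLinearGroup (Fin 2) F)) =
      2 * ((Nat.card F : ℝ) ^ 4 - (Nat.card F : ℝ) ^ 3 - 2 * (Nat.card F : ℝ) ^ 2 - Nat.card F) := by
  have hne (g : Matrix.GeneralLinearGroup (Fin 2) F) :
      g ∉ Subgroup.center (Matrix.GeneralLinearGroup (Fin 2) F) ↔ coordsModScalars g.val ≠ 0 :=
    not_congr (Matrix.GeneralLinearGroup.mem_center_iff_val_mem_range_scalar.trans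
      coordsModScalars_eq_zero.symm)
  rw [graphEnergy_commutingGraph
    (fun g => Projectivization.mk F (coordsModScalars g.1.val) ((hne g.1).mp g.2)),
    card_GL_two, card_center_GL_two, card_projectivization_fin]
  · simp [Finset.sum_range_succ]
    ring
  · intro P
    induction P with
    | h v hv =>
      obtain ⟨M, hM, rfl⟩ := exists_coordsModScalars_eq hF v
      exact ⟨⟨Matrix.GeneralLinearGroup.mkOfDetNeZero M hM, (hne _).mpr hv⟩, rfl⟩
  · intro x y
    rw [projectivization_mk_eq_mk_iff_minors, ← mul_comm_iff_coordsModScalars, Units.ext_iff,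
      Units.val_mul, Units.val_mul]

theorem center_SL_two_eq_bot [CharP F 2] :
    Subgroup.center (Matrix.SpecialLinearGroup (Fin 2) F) = ⊥ := by
  rw [eq_bot_iff]
  intro g hg
  obtain ⟨r, hr, hg⟩ := Matrix.SpecialLinearGroup.mem_center_iff.mp hg
  have : r = 1 := by
    apply frobenius_inj F 2
    simpa [frobenius_def] using hr
  subst this
  exact Subtype.ext (by simpa using hg.symm)

/-- In characteristic two every element is a square, so every invertible matrix can be rescaled to
determinant one: `SL(2, F)` meets the same centralizers as `GL(2, F)`. -/
theorem graphEnergy_commutingGraph_SL_two [Finite F] [CharP F 2] (hF : 2 < Nat.card F) :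
    graphEnergy (commutingGraph (Matrix.SpecialLinearGroup (Fin 2) F)) =
      2 * ((Nat.card F : ℝ) ^ 3 - (Nat.card F : ℝ) ^ 2 - 2 * Nat.card F - 2) := by
  have hne (g : Matrix.SpecialLinearGroup (Fin 2) F) :
      g ∉ Subgroup.center (Matrix.SpecialLinearGroup (Fin 2) F) ↔
        coordsModScalars (g : Matrix (Fin 2) (Fin 2) F) ≠ 0 := by
    rw [← Matrix.SpecialLinearGroup.toGL_mem_center_iff]
    exact not_congr (Matrix.GeneralLinearGroup.mem_center_iff_val_mem_range_scalar.trans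
      coordsModScalars_eq_zero.symm)
  rw [graphEnergy_commutingGraph
    (fun g : {x // x ∉ Subgroup.center (Matrix.SpecialLinearGroup (Fin 2) F)} =>
      Projectivization.mk F (coordsModScalars (g.1 : Matrix (Fin 2) (Fin 2) F)) ((hne g.1).mp g.2)),
    card_SL_two, center_SL_two_eq_bot, card_projectivization_fin]
  · simp [Finset.sum_range_succ]
    ring
  · intro P
    induction P with
    | h v hv =>
      obtain ⟨M, hM, hMv⟩ := exists_coordsModScalars_eq hF v
      obtain ⟨s, hs⟩ : ∃ s, frobenius F 2 s = M.det :=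
        (Finite.injective_iff_surjective.mp (frobenius_inj F 2)) _
      rw [frobenius_def] at hs
      have hs0 : s ≠ 0 := fun h => hM (by rw [← hs, h, zero_pow two_ne_zero])
      have hdet : (s⁻¹ • M).det = 1 := by
        rw [Matrix.det_smul, Fintype.card_fin, ← hs, inv_pow, inv_mul_cancel₀ (pow_ne_zero 2 hs0)]
      have hsv : coordsModScalars (s⁻¹ • M) = s⁻¹ • v := by
        rw [← hMv]
        ext i
        fin_cases i <;> simp [coordsModScalars, mul_sub]
      refine ⟨⟨⟨s⁻¹ • M, hdet⟩, (hne _).mpr ?_⟩, ?_⟩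
      · rw [hsv]
        exact smul_ne_zero (inv_ne_zero hs0) hv
      · rw [Projectivization.mk_eq_mk_iff']
        exact ⟨s⁻¹, hsv.symm⟩
  · intro x y
    rw [projectivization_mk_eq_mk_iff_minors, ← mul_comm_iff_coordsModScalars,
      ← Matrix.SpecialLinearGroup.coe_mul, ← Matrix.SpecialLinearGroup.coe_mul]
    exact Subtype.ext_iff

theorem graphEnergy_commutingGraph_PSL_two [Finite F] [CharP F 2] (hF : 2 < Nat.card F) :
    graphEnergy (commutingGraph (Matrix.ProjectiveSpecialLinearGroup (Fin 2) F)) =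
      2 * ((Nat.card F : ℝ) ^ 3 - (Nat.card F : ℝ) ^ 2 - 2 * Nat.card F - 2) := by
  rw [← graphEnergy_commutingGraph_SL_two hF]
  exact graphEnergy_commutingGraph_congr
    ((QuotientGroup.quotientMulEquivOfEq center_SL_two_eq_bot).trans QuotientGroup.quotientBot)

/-! ### Unitriangular groups -/

variable (F) in
/-- The coordinates `(a, b, c)` of the matrix `V(a, b, c)`. -/
def groupAPEquiv : groupAP F ≃ F × F × F where
  toFun g := (g.1.1 1 0, g.1.1 2 0, g.1.1 2 1)
  invFun t := ⟨⟨!![1, 0, 0; t.1, 1, 0; t.2.1, t.2.2, 1], by simp [Matrix.det_fin_three]⟩,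
    t.1, t.2.1, t.2.2, rfl⟩
  left_inv g := by
    obtain ⟨⟨M, hM⟩, a, b, c, h⟩ := g
    change M = _ at h
    subst h
    rfl
  right_inv t := rfl

theorem groupAPEquiv_apply (g : groupAP F) :
    groupAPEquiv F g = (g.1.1 1 0, g.1.1 2 0, g.1.1 2 1) := rfl

theorem groupAPEquiv_mul (g h : groupAP F) :
    groupAPEquiv F (g * h) = ((groupAPEquiv F g).1 + (groupAPEquiv F h).1,
      (groupAPEquiv F g).2.1 + (groupAPEquiv F g).2.2 * (groupAPEquiv F h).1 +
        (groupAPEquiv F h).2.1,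
      (groupAPEquiv F g).2.2 + (groupAPEquiv F h).2.2) := by
  obtain ⟨a, b, c, hg⟩ := g.2
  obtain ⟨a', b', c', hh⟩ := h.2
  simp [groupAPEquiv_apply, hg, hh, Matrix.mul_apply, Fin.sum_univ_three]

theorem groupAP_mul_comm_iff (g h : groupAP F) : g * h = h * g ↔
    (groupAPEquiv F g).1 * (groupAPEquiv F h).2.2 =
      (groupAPEquiv F g).2.2 * (groupAPEquiv F h).1 := by
  rw [← (groupAPEquiv F).injective.eq_iff, groupAPEquiv_mul, groupAPEquiv_mul]
  simp only [Prod.mk.injEq]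
  grind

theorem mem_center_groupAP (g : groupAP F) : g ∈ Subgroup.center (groupAP F) ↔
    (groupAPEquiv F g).1 = 0 ∧ (groupAPEquiv F g).2.2 = 0 := by
  simp only [Subgroup.mem_center_iff, groupAP_mul_comm_iff, (groupAPEquiv F).forall_congr_left,
    Equiv.apply_symm_apply, Prod.forall]
  constructor
  · intro h
    constructor
    · simpa using (h 0 0 1).symm
    · simpa using h 1 0 0
  · rintro ⟨h1, h2⟩
    simp [h1, h2]

/-- `V(a, b, c)` and `V(a', b', c')` commute iff `(a, c)` and `(a', c')` are proportional, so the
cliques are the points of the projective line. -/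
theorem graphEnergy_commutingGraph_groupAP [Finite F] :
    graphEnergy (commutingGraph (groupAP F)) =
      2 * (Nat.card F : ℝ) ^ 3 - 4 * Nat.card F - 2 := by
  have hne (g : groupAP F) : g ∉ Subgroup.center (groupAP F) ↔
      ![(groupAPEquiv F g).1, (groupAPEquiv F g).2.2] ≠ 0 := by
    rw [mem_center_groupAP]
    simp
  have hZ : Nat.card (Subgroup.center (groupAP F)) = Nat.card F := by
    refine Nat.card_congr (Equiv.ofBijective (fun g => (groupAPEquiv F g.1).2.1) ⟨?_, ?_⟩)
    · rintro ⟨g, hg⟩ ⟨h, hh⟩ hgh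
      rw [mem_center_groupAP] at hg hh
      refine Subtype.ext ((groupAPEquiv F).injective ?_)
      exact Prod.ext (hg.1.trans hh.1.symm) (Prod.ext hgh (hg.2.trans hh.2.symm))
    · intro b
      exact ⟨⟨(groupAPEquiv F).symm (0, b, 0), by simp [mem_center_groupAP]⟩, by simp⟩
  rw [graphEnergy_commutingGraph
    (fun g => Projectivization.mk F ![(groupAPEquiv F g.1).1, (groupAPEquiv F g.1).2.2]
      ((hne g.1).mp g.2)), hZ, Nat.card_congr (groupAPEquiv F), card_projectivization_fin]
  · simp [Finset.sum_range_succ]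
    ring
  · intro P
    induction P with
    | h v hv =>
      have hv' : ![v 0, v 1] = v := by
        ext i
        fin_cases i <;> rfl
      refine ⟨⟨(groupAPEquiv F).symm (v 0, 0, v 1), (hne _).mpr (by simpa [hv'] using hv)⟩, ?_⟩
      simp [hv']
  · intro x y
    rw [projectivization_mk_eq_mk_iff_minors]
    refine (groupAP_mul_comm_iff x.1 y.1).trans ⟨fun h i j => ?_, fun h => h 0 1⟩
    fin_cases i <;> fin_cases j <;> simp <;> grind

/-- The coordinates `(a, b)` of the matrix `U(a, b)`. -/
def groupAThetaEquiv (θ : F ≃+* F) : groupATheta θ ≃ F × F where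
  toFun g := (g.1.1 1 0, g.1.1 2 0)
  invFun t := ⟨⟨!![1, 0, 0; t.1, 1, 0; t.2, θ t.1, 1], by simp [Matrix.det_fin_three]⟩,
    t.1, t.2, rfl⟩
  left_inv g := by
    obtain ⟨⟨M, hM⟩, a, b, h⟩ := g
    change M = _ at h
    subst h
    rfl
  right_inv t := rfl

theorem groupAThetaEquiv_apply (θ : F ≃+* F) (g : groupATheta θ) :
    groupAThetaEquiv θ g = (g.1.1 1 0, g.1.1 2 0) := rfl

theorem groupAThetaEquiv_mul (θ : F ≃+* F) (g h : groupATheta θ) :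
    groupAThetaEquiv θ (g * h) = ((groupAThetaEquiv θ g).1 + (groupAThetaEquiv θ h).1,
      (groupAThetaEquiv θ g).2 + θ (groupAThetaEquiv θ g).1 * (groupAThetaEquiv θ h).1 +
        (groupAThetaEquiv θ h).2) := by
  obtain ⟨a, b, hg⟩ := g.2
  obtain ⟨a', b', hh⟩ := h.2
  simp [groupAThetaEquiv_apply, hg, hh, Matrix.mul_apply, Fin.sum_univ_three]

theorem groupATheta_mul_comm_iff {θ : F ≃+* F} (hθ : ∀ x, θ x = x ^ 2) (g h : groupATheta θ) :
    g * h = h * g ↔ (groupAThetaEquiv θ g).1 = 0 ∨ (groupAThetaEquiv θ h).1 = 0 ∨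
      (groupAThetaEquiv θ g).1 = (groupAThetaEquiv θ h).1 := by
  rw [← (groupAThetaEquiv θ).injective.eq_iff, groupAThetaEquiv_mul, groupAThetaEquiv_mul]
  simp only [Prod.mk.injEq, hθ]
  grind

theorem mem_center_groupATheta [Finite F] {θ : F ≃+* F} (hθ : ∀ x, θ x = x ^ 2)
    (hF : 2 < Nat.card F) (g : groupATheta θ) :
    g ∈ Subgroup.center (groupATheta θ) ↔ (groupAThetaEquiv θ g).1 = 0 := by
  simp only [Subgroup.mem_center_iff, groupATheta_mul_comm_iff hθ,
    (groupAThetaEquiv θ).forall_congr_left, Equiv.apply_symm_apply, Prod.forall]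
  constructor
  · intro h
    -- A third element of the field tells `a ≠ 0` apart from both `0` and itself.
    obtain ⟨t, ht⟩ : ∃ t : F, t ∉ ({0, (groupAThetaEquiv θ g).1} : Set F) := by
      by_contra! hall
      have h1 := Set.ncard_le_ncard (fun t _ => hall t : Set.univ ⊆ _) (Set.toFinite _)
      have h2 := Set.ncard_insert_le (0 : F) {(groupAThetaEquiv θ g).1}
      rw [Set.ncard_univ] at h1
      rw [Set.ncard_singleton] at h2
      omega
    simp only [Set.mem_insert_iff, Set.mem_singleton_iff, not_or] at ht
    rcases h t 0 with h | h | h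
    · exact absurd h ht.1
    · exact h
    · exact absurd h ht.2
  · intro h
    simp [h]

theorem graphEnergy_commutingGraph_groupATheta [Finite F] (θ : F ≃+* F) (hθ : ∀ x, θ x = x ^ 2)
    (hF : 2 < Nat.card F) :
    graphEnergy (commutingGraph (groupATheta θ)) = 2 * ((Nat.card F : ℝ) - 1) ^ 2 := by
  have hne (g : groupATheta θ) : g ∉ Subgroup.center (groupATheta θ) ↔
      (groupAThetaEquiv θ g).1 ≠ 0 := (mem_center_groupATheta hθ hF g).not
  have hZ : Nat.card (Subgroup.center (groupATheta θ)) = Nat.card F := by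
    refine Nat.card_congr (Equiv.ofBijective (fun g => (groupAThetaEquiv θ g.1).2) ⟨?_, ?_⟩)
    · rintro ⟨g, hg⟩ ⟨h, hh⟩ hgh
      rw [mem_center_groupATheta hθ hF] at hg hh
      exact Subtype.ext ((groupAThetaEquiv θ).injective (Prod.ext (hg.trans hh.symm) hgh))
    · intro b
      exact ⟨⟨(groupAThetaEquiv θ).symm (0, b), by simp [mem_center_groupATheta hθ hF]⟩, by simp⟩
  rw [graphEnergy_commutingGraph (fun g => Units.mk0 _ ((hne g.1).mp g.2)), hZ,
    Nat.card_congr (groupAThetaEquiv θ), Nat.card_units, Nat.cast_sub Nat.card_pos]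
  · simp
    ring
  · intro u
    exact ⟨⟨(groupAThetaEquiv θ).symm (u, 0), (hne _).mpr (by simp)⟩, Units.ext (by simp)⟩
  · rintro ⟨x, hx⟩ ⟨y, hy⟩
    rw [groupATheta_mul_comm_iff hθ, Units.mk0_inj, or_iff_right ((hne x).mp hx),
      or_iff_right ((hne y).mp hy)]

end Matrices

/-! ### Non-Abelian groups of order `p * q` -/

theorem prime_card_of_ne_bot_of_ne_top {G : Type*} [Group G] [Finite G] {p q : ℕ} (hp : p.Prime)
    (hq : q.Prime) (hG : Nat.card G = p * q) {H : Subgroup G} (hbot : H ≠ ⊥) (htop : H ≠ ⊤) :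
    Nat.card H = p ∨ Nat.card H = q := by
  have hdvd : Nat.card H ∣ p * q := hG ▸ H.card_subgroup_dvd_card
  obtain ⟨a, b, ha, hb, hab⟩ := Nat.dvd_mul.mp hdvd
  rcases (Nat.dvd_prime hp).mp ha with rfl | rfl <;>
    rcases (Nat.dvd_prime hq).mp hb with rfl | rfl
  · exact absurd (H.card_eq_one.mp (by simpa using hab.symm)) hbot
  · exact Or.inr (by simpa using hab.symm)
  · exact Or.inl (by simpa using hab.symm)
  · exact absurd (H.eq_top_of_card_eq (hab.symm.trans hG.symm)) htop

theorem center_eq_bot_of_card_eq_mul_prime {G : Type*} [Group G] [Finite G] {p q : ℕ}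
    (hp : p.Prime) (hq : q.Prime) (hG : Nat.card G = p * q) (hna : ¬ ∀ x y : G, x * y = y * x) :
    Subgroup.center G = ⊥ := by
  by_contra hbot
  have htop : Subgroup.center G ≠ ⊤ := fun h =>
    hna fun x y => (Subgroup.mem_center_iff.mp (h ▸ Subgroup.mem_top y) x)
  -- Otherwise `G ⧸ Z(G)` has prime order, hence is cyclic, hence `G` is commutative
  have hprime : (Nat.card (G ⧸ Subgroup.center G)).Prime := by
    have h := (Subgroup.center G).card_eq_card_quotient_mul_card_subgroup
    rw [hG] at h
    rcases prime_card_of_ne_bot_of_ne_top hp hq hG hbot htop with h1 | h1 <;> rw [h1] at h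
    · rw [mul_comm] at h
      rwa [← Nat.eq_of_mul_eq_mul_right hp.pos h]
    · rwa [← Nat.eq_of_mul_eq_mul_right hq.pos h]
  have : Fact (Nat.card (G ⧸ Subgroup.center G)).Prime := ⟨hprime⟩
  have : IsCyclic (G ⧸ Subgroup.center G) := isCyclic_of_prime_card rfl
  have := (QuotientGroup.mk' (Subgroup.center G)).isMulCommutative_of_isCyclic_of_ker_le_center
    (by simp)
  exact hna fun x y => this.is_comm.comm x y

/-- In a non-Abelian group of order `p * q` a nontrivial element generates its own centralizer,
which has prime order. -/
theorem zpowers_eq_centralizer {G : Type*} [Group G] [Finite G] {p q : ℕ}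
    (hp : p.Prime) (hq : q.Prime) (hG : Nat.card G = p * q) (hna : ¬ ∀ x y : G, x * y = y * x)
    {x y : G} (hx : x ≠ 1) (hy : y ≠ 1) (hxy : x * y = y * x) :
    Subgroup.zpowers y = Subgroup.centralizer {x} := by
  have hZ := center_eq_bot_of_card_eq_mul_prime hp hq hG hna
  have hmem : y ∈ Subgroup.centralizer {x} := by
    rw [Subgroup.mem_centralizer_singleton_iff]
    exact hxy.symm
  have hle : Subgroup.zpowers y ≤ Subgroup.centralizer {x} := by
    rwa [Subgroup.zpowers_le]
  have hbot : Subgroup.zpowers y ≠ ⊥ := by rwa [Ne, Subgroup.zpowers_eq_bot]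
  have htop : Subgroup.centralizer {x} ≠ ⊤ := by
    intro h
    refine hx ((Subgroup.eq_bot_iff_forall _).mp hZ x (Subgroup.mem_center_iff.mpr fun g => ?_))
    exact Subgroup.mem_centralizer_singleton_iff.mp (h ▸ Subgroup.mem_top g)
  have hprime : (Nat.card (Subgroup.centralizer {x})).Prime := by
    rcases prime_card_of_ne_bot_of_ne_top hp hq hG (ne_bot_of_le_ne_bot hbot hle) htop with h | h <;>
      rwa [h]
  refine Subgroup.eq_of_le_of_card_ge hle (Nat.le_of_dvd Nat.card_pos ?_)
  rcases (Nat.dvd_prime hprime).mp (Subgroup.card_dvd_of_le hle) with h | h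
  · exact absurd (Subgroup.card_eq_one.mp h) hbot
  · rw [h]

theorem factorization_mul_prime_left {p q : ℕ} (hp : p.Prime) (hq : q.Prime) (hpq : p ≠ q) :
    (p * q).factorization p = 1 := by
  rw [Nat.factorization_mul hp.ne_zero hq.ne_zero, Finsupp.add_apply, hp.factorization_self,
    Nat.factorization_eq_zero_of_not_dvd]
  rwa [Nat.prime_dvd_prime_iff_eq hp hq]

/-- When the prime `p` exactly divides the order of the group, the subgroups of order `p` are the
Sylow `p`-subgroups. -/
theorem card_subgroups_eq_card_sylow {G : Type*} [Group G] [Finite G] {p q : ℕ} [Fact p.Prime]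
    (hq : q.Prime) (hpq : p ≠ q) (hG : Nat.card G = p * q) :
    Nat.card {H : Subgroup G // Nat.card H = p} = Nat.card (Sylow p G) := by
  have hfac : p ^ (Nat.card G).factorization p = p := by
    rw [hG, factorization_mul_prime_left Fact.out hq hpq, pow_one]
  refine Nat.card_congr
    { toFun := fun H => Sylow.ofCard H.1 (H.2.trans hfac.symm)
      invFun := fun P => ⟨P.1, (Sylow.card_eq_multiplicity P).trans hfac⟩
      left_inv := fun H => rfl
      right_inv := fun P => Sylow.ext rfl }

theorem graphEnergy_commutingGraph_of_card_eq_mul_prime {G : Type*} [Group G] [Finite G] {p q : ℕ}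
    (hp : p.Prime) (hq : q.Prime) (hdvd : p ∣ q - 1) (hG : Nat.card G = p * q)
    (hna : ¬ ∀ x y : G, x * y = y * x) :
    graphEnergy (commutingGraph G) = 2 * (q : ℝ) * (p - 1) - 4 := by
  have hlt : p < q := by
    have := Nat.le_of_dvd (by have := hq.two_le; omega) hdvd
    have := hq.two_le
    omega
  have : Fact p.Prime := ⟨hp⟩
  have : Fact q.Prime := ⟨hq⟩
  have hZ := center_eq_bot_of_card_eq_mul_prime hp hq hG hna
  have hcomm {x y : G} (hx : x ≠ 1) (hy : y ≠ 1) :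
      x * y = y * x ↔ Subgroup.zpowers x = Subgroup.zpowers y := by
    constructor
    · intro h
      rw [zpowers_eq_centralizer hp hq hG hna hx hx rfl,
        zpowers_eq_centralizer hp hq hG hna hx hy h]
    · intro h
      obtain ⟨k, rfl⟩ : y ∈ Subgroup.zpowers x := h ▸ Subgroup.mem_zpowers y
      exact (Commute.refl x).zpow_right k
  have hcard {x : G} (hx : x ≠ 1) :
      Nat.card (Subgroup.zpowers x) = p ∨ Nat.card (Subgroup.zpowers x) = q := by
    refine prime_card_of_ne_bot_of_ne_top hp hq hG (by rwa [Ne, Subgroup.zpowers_eq_bot]) fun h => ?_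
    refine hna fun a b => ?_
    obtain ⟨i, rfl⟩ : a ∈ Subgroup.zpowers x := h ▸ Subgroup.mem_top a
    obtain ⟨j, rfl⟩ : b ∈ Subgroup.zpowers x := h ▸ Subgroup.mem_top b
    exact (Commute.refl x).zpow_zpow i j
  have cardSylow {r s : ℕ} [Fact r.Prime] [Fact s.Prime] (hrs : r ≠ s)
      (hG : Nat.card G = r * s) : ∀ R : Sylow r G, Nat.card R = r := fun R => by
    rw [Sylow.card_eq_multiplicity, hG, factorization_mul_prime_left Fact.out Fact.out hrs, pow_one]
  have cardSylow_dvd {r s : ℕ} [Fact r.Prime] [Fact s.Prime] (hrs : r ≠ s)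
      (hG : Nat.card G = r * s) : Nat.card (Sylow r G) ∣ s := by
    let R : Sylow r G := default
    have h := (R : Subgroup G).card_mul_index
    rw [cardSylow hrs hG R, hG] at h
    exact (Nat.eq_of_mul_eq_mul_left (Fact.out : r.Prime).pos h) ▸ R.card_dvd_index
  have hG' : Nat.card G = q * p := hG.trans (mul_comm p q)
  have hnq : Nat.card (Sylow q G) = 1 :=
    Nat.ModEq.eq_of_lt_of_lt (card_sylow_modEq_one q G)
      ((Nat.le_of_dvd hp.pos (cardSylow_dvd hlt.ne' hG')).trans_lt hlt) hq.one_lt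
  have hnp : Nat.card (Sylow p G) = q := by
    refine ((Nat.dvd_prime hq).mp (cardSylow_dvd hlt.ne hG)).resolve_left fun h1 => ?_
    -- Two normal Sylow subgroups would commute elementwise, so that nontrivial elements of both
    -- would generate the same subgroup, although the two meet trivially.
    have : Subsingleton (Sylow p G) := (Nat.card_eq_one_iff_unique.mp h1).1
    have : Subsingleton (Sylow q G) := (Nat.card_eq_one_iff_unique.mp hnq).1
    let P : Sylow p G := default
    let Q : Sylow q G := default
    have hdisj : Disjoint (P : Subgroup G) (Q : Subgroup G) := by
      refine Subgroup.disjoint_of_coprime_natCard ?_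
      rw [cardSylow hlt.ne hG P, cardSylow hlt.ne' hG' Q]
      exact (Nat.coprime_primes hp hq).mpr hlt.ne
    have hP : Nontrivial P := by
      rw [← Finite.one_lt_card_iff_nontrivial, cardSylow hlt.ne hG P]
      exact hp.one_lt
    have hQ : Nontrivial Q := by
      rw [← Finite.one_lt_card_iff_nontrivial, cardSylow hlt.ne' hG' Q]
      exact hq.one_lt
    obtain ⟨⟨x, hxP⟩, hx⟩ := exists_ne (1 : P)
    obtain ⟨⟨y, hyQ⟩, hy⟩ := exists_ne (1 : Q)
    have hx1 : x ≠ 1 := fun h => hx (Subtype.ext h)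
    have hy1 : y ≠ 1 := fun h => hy (Subtype.ext h)
    have hxy := Subgroup.commute_of_normal_of_disjoint _ _ P.normal_of_subsingleton
      Q.normal_of_subsingleton hdisj x y hxP hyQ
    have hmem : x ∈ (Q : Subgroup G) :=
      (Subgroup.zpowers_le.mpr hyQ) ((hcomm hx1 hy1).mp hxy ▸ Subgroup.mem_zpowers x)
    exact hx1 (Subgroup.disjoint_def.mp hdisj hxP hmem)
  have hι : Nat.card {H : Subgroup G // Nat.card H = p ∨ Nat.card H = q} = q + 1 := by
    classical
    rw [Nat.card_congr (subtypeOrEquiv _ _ ?_), Nat.card_sum,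
      card_subgroups_eq_card_sylow hq hlt.ne hG, card_subgroups_eq_card_sylow hp hlt.ne' hG', hnp, hnq]
    rw [Pi.disjoint_iff]
    intro H
    rw [Prop.disjoint_iff]
    by_contra! h
    exact hlt.ne (h.1.symm.trans h.2)
  have hne (x : G) : x ∉ Subgroup.center G ↔ x ≠ 1 := by rw [hZ, Subgroup.mem_bot]
  rw [graphEnergy_commutingGraph
    (ι := {H : Subgroup G // Nat.card H = p ∨ Nat.card H = q})
    (fun x => ⟨Subgroup.zpowers x.1, hcard ((hne _).mp x.2)⟩), hι, hZ, hG]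
  · simp
    ring
  · rintro ⟨H, hH⟩
    have hbot : H ≠ ⊥ := by
      rintro rfl
      rw [Subgroup.card_bot] at hH
      rcases hH with h | h
      · exact hp.ne_one h.symm
      · exact hq.ne_one h.symm
    obtain ⟨⟨x, hxH⟩, hx⟩ := Subgroup.ne_bot_iff_exists_ne_one.mp hbot
    have hx1 : x ≠ 1 := fun h => hx (Subtype.ext h)
    have hHp : (Nat.card H).Prime := by
      rcases hH with h | h <;> rwa [h]
    have hle : Subgroup.zpowers x ≤ H := Subgroup.zpowers_le.mpr hxH
    refine ⟨⟨x, (hne x).mpr hx1⟩, Subtype.ext (Subgroup.eq_of_le_of_card_ge hle (le_of_eq ?_))⟩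
    refine (((Nat.dvd_prime hHp).mp (Subgroup.card_dvd_of_le hle)).resolve_left fun h => hx1 ?_).symm
    rwa [Subgroup.card_eq_one, Subgroup.zpowers_eq_bot] at h
  · rintro ⟨x, hx⟩ ⟨y, hy⟩
    rw [Subtype.mk.injEq]
    exact hcomm ((hne x).mp hx) ((hne y).mp hy)

/-! ### One-dimensional affine groups -/

/-- The affine group of a commutative ring: the pair `⟨u, t⟩` stands for the map
`x ↦ u * x + t`. -/
@[ext]
structure AffineGroup (R : Type*) [CommRing R] where
  /-- the linear part -/
  scale : Rˣ
  /-- the translation part -/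
  shift : R

namespace AffineGroup

variable {R : Type*} [CommRing R]

instance : Mul (AffineGroup R) := ⟨fun x y => ⟨x.scale * y.scale, x.scale * y.shift + x.shift⟩⟩
instance : One (AffineGroup R) := ⟨⟨1, 0⟩⟩
instance : Inv (AffineGroup R) := ⟨fun x => ⟨x.scale⁻¹, -(↑x.scale⁻¹ * x.shift)⟩⟩

@[simp] theorem scale_mul (x y : AffineGroup R) : (x * y).scale = x.scale * y.scale := rfl
@[simp] theorem shift_mul (x y : AffineGroup R) :
    (x * y).shift = x.scale * y.shift + x.shift := rfl
@[simp] theorem scale_one : (1 : AffineGroup R).scale = 1 := rfl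
@[simp] theorem shift_one : (1 : AffineGroup R).shift = 0 := rfl
@[simp] theorem scale_inv (x : AffineGroup R) : x⁻¹.scale = x.scale⁻¹ := rfl
@[simp] theorem shift_inv (x : AffineGroup R) : x⁻¹.shift = -(↑x.scale⁻¹ * x.shift) := rfl

instance : Group (AffineGroup R) :=
  Group.ofLeftAxioms
    (fun x y z => AffineGroup.ext (mul_assoc _ _ _) (by simp; ring))
    (fun x => AffineGroup.ext (one_mul _) (by simp))
    (fun x => AffineGroup.ext (inv_mul_cancel _) (by simp))

theorem mul_comm_iff (x y : AffineGroup R) :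
    x * y = y * x ↔ ((x.scale : R) - 1) * y.shift = (y.scale - 1) * x.shift := by
  rw [AffineGroup.ext_iff, scale_mul, scale_mul, shift_mul, shift_mul]
  constructor
  · rintro ⟨-, h⟩
    linear_combination h
  · intro h
    exact ⟨mul_comm _ _, by linear_combination h⟩

theorem translation_pow (t : R) (i : ℕ) : (⟨1, t⟩ : AffineGroup R) ^ i = ⟨1, i * t⟩ := by
  induction i with
  | zero => ext <;> simp
  | succ i ih =>
    rw [pow_succ, ih]
    ext <;> simp
    ring

/-- Powers of an affine map that fixes the point `t`. -/
theorem fixing_pow (u : Rˣ) (t : R) (i : ℕ) :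
    (⟨u, t * (1 - u)⟩ : AffineGroup R) ^ i = ⟨u ^ i, t * (1 - u ^ i)⟩ := by
  induction i with
  | zero => ext <;> simp
  | succ i ih =>
    rw [pow_succ, ih]
    ext
    · simp [pow_succ]
    · simp
      ring

theorem homothety_pow (u : Rˣ) (i : ℕ) : (⟨u, 0⟩ : AffineGroup R) ^ i = ⟨u ^ i, 0⟩ := by
  simpa using fixing_pow u 0 i

variable (R) in
theorem card : Nat.card (AffineGroup R) = Nat.card Rˣ * Nat.card R := by
  rw [← Nat.card_prod]
  exact Nat.card_congr
    { toFun := fun x => (x.scale, x.shift)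
      invFun := fun x => ⟨x.1, x.2⟩
      left_inv := fun _ => rfl
      right_inv := fun _ => rfl }

/-- Commuting affine maps over a prime field are powers of one affine map: of a translation, or of
a generator of the cyclic stabilizer of their common fixed point. -/
theorem exists_pow_eq_of_commute {p : ℕ} [Fact p.Prime] {x y : AffineGroup (ZMod p)}
    (hxy : x * y = y * x) : ∃ (g : AffineGroup (ZMod p)) (i j : ℕ), g ^ i = x ∧ g ^ j = y := by
  wlog hx : x.scale ≠ 1 ∨ y.scale = 1 generalizing x y
  · push Not at hx
    obtain ⟨g, i, j, hi, hj⟩ := this hxy.symm (Or.inl hx.2)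
    exact ⟨g, j, i, hj, hi⟩
  rw [mul_comm_iff] at hxy
  by_cases hx1 : x.scale = 1
  · have hy1 : y.scale = 1 := hx.resolve_left (not_not.mpr hx1)
    refine ⟨⟨1, 1⟩, x.shift.val, y.shift.val, ?_, ?_⟩ <;> rw [translation_pow] <;> ext <;>
      simp [hx1, hy1]
  · obtain ⟨u, hu⟩ := IsCyclic.exists_generator (α := (ZMod p)ˣ)
    have hs : (1 : ZMod p) - x.scale ≠ 0 := fun h => hx1 (Units.ext (sub_eq_zero.mp h).symm)
    obtain ⟨i, hi⟩ := mem_powers_iff_mem_zpowers.mpr (hu x.scale)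
    obtain ⟨j, hj⟩ := mem_powers_iff_mem_zpowers.mpr (hu y.scale)
    simp only at hi hj
    refine ⟨⟨u, x.shift / (1 - x.scale) * (1 - u)⟩, i, j, ?_, ?_⟩ <;> rw [fixing_pow] <;> ext1
    · exact hi
    · rw [← Units.val_pow_eq_pow_val, hi]
      exact div_mul_cancel₀ _ hs
    · exact hj
    · rw [← Units.val_pow_eq_pow_val, hj]
      simp only
      field_simp
      linear_combination hxy

end AffineGroup

open AffineGroup in
/-- Groups whose central quotient is the affine group of a prime field: elements commute iff their
images do, and the cliques correspond to the points `(u - 1 : t)` of the projective line, that is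
to the translation subgroup and the `p` point stabilizers. -/
theorem graphEnergy_commutingGraph_of_affine_quotient {G : Type*} [Group G] [Finite G] {p : ℕ}
    [Fact p.Prime] (hp : p ≠ 2) (ψ : G →* AffineGroup (ZMod p)) (hψ : Function.Surjective ψ)
    (hker : ψ.ker = Subgroup.center G) :
    graphEnergy (commutingGraph G) =
      2 * (((p : ℝ) * (p - 1) - 1) * Nat.card (Subgroup.center G) - (p + 1)) := by
  have hcomm (x y : G) : x * y = y * x ↔ ψ x * ψ y = ψ y * ψ x := by
    constructor
    · intro h
      rw [← map_mul, h, map_mul]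
    · intro h
      obtain ⟨γ, i, j, hi, hj⟩ := exists_pow_eq_of_commute h
      obtain ⟨g, rfl⟩ := hψ γ
      have hmem {x : G} {i : ℕ} (hi : ψ g ^ i = ψ x) : ∃ z ∈ Subgroup.center G, x = g ^ i * z := by
        refine ⟨(g ^ i)⁻¹ * x, ?_, by group⟩
        rw [← hker, MonoidHom.mem_ker, map_mul, map_inv, map_pow, hi, inv_mul_cancel]
      obtain ⟨z, hz, rfl⟩ := hmem hi
      obtain ⟨w, hw, rfl⟩ := hmem hj
      have hz' (a : G) : Commute a z := Subgroup.mem_center_iff.mp hz a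
      have hw' (a : G) : Commute a w := Subgroup.mem_center_iff.mp hw a
      exact Commute.mul_right (((Commute.refl g).pow_pow i j).mul_left (hz' _).symm) (hw' _)
  have hne (x : G) : x ∉ Subgroup.center G ↔
      ![((ψ x).scale : ZMod p) - 1, (ψ x).shift] ≠ 0 := by
    rw [← hker, MonoidHom.mem_ker, not_iff_not, AffineGroup.ext_iff]
    simp [sub_eq_zero]
  have hcard : Nat.card G = (p - 1) * p * Nat.card (Subgroup.center G) := by
    rw [← hker, ← ψ.ker.index_mul_card, Subgroup.index_ker, MonoidHom.range_eq_top.mpr hψ,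
      Subgroup.card_top, AffineGroup.card, Nat.card_zmod, Nat.card_units, Nat.card_zmod]
  rw [graphEnergy_commutingGraph (fun x => Projectivization.mk (ZMod p)
    ![((ψ x.1).scale : ZMod p) - 1, (ψ x.1).shift] ((hne x.1).mp x.2)), hcard,
    card_projectivization_fin, Nat.card_zmod]
  · rw [Nat.cast_mul, Nat.cast_mul, Nat.cast_sub (Fact.out : p.Prime).one_le]
    simp [Finset.sum_range_succ]
    ring
  · intro P
    induction P with
    | h v hv =>
      have h2 : (2 : ZMod p) ≠ 0 := by
        have : ¬ p ∣ 2 := fun h => hp ((Nat.prime_dvd_prime_iff_eq Fact.out Nat.prime_two).mp h)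
        rwa [← Nat.cast_two, Ne, ZMod.natCast_eq_zero_iff]
      -- The direction `(0 : t)` is that of a translation; any other one contains a vector `(1, t)`,
      -- and `2 - 1 = 1`, where `2` is a unit.
      obtain ⟨γ, c, hγ⟩ : ∃ (γ : AffineGroup (ZMod p)) (c : (ZMod p)ˣ),
          c • v = ![(γ.scale : ZMod p) - 1, γ.shift] := by
        by_cases h0 : v 0 = 0
        · refine ⟨⟨1, v 1⟩, 1, ?_⟩
          ext i
          fin_cases i <;> simp [h0]
        · refine ⟨⟨Units.mk0 2 h2, (v 0)⁻¹ * v 1⟩, Units.mk0 _ (inv_ne_zero h0), ?_⟩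
          ext i
          fin_cases i
          · simp [Units.smul_def, h0]
            norm_num
          · simp [Units.smul_def]
      obtain ⟨x, rfl⟩ := hψ γ
      have hx : ![((ψ x).scale : ZMod p) - 1, (ψ x).shift] ≠ 0 := by
        rw [← hγ]
        exact (smul_ne_zero_iff_ne c).mpr hv
      exact ⟨⟨x, (hne x).mpr hx⟩, (Projectivization.mk_eq_mk_iff _ _ _ hx hv).mpr ⟨c, hγ⟩⟩
  · intro x y
    rw [projectivization_mk_eq_mk_iff_minors, hcomm, AffineGroup.mul_comm_iff]
    constructor
    · intro h i j
      fin_cases i <;> fin_cases j <;> simp <;> grind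
    · intro h
      have := h 0 1
      simp at this
      linear_combination this

/-! ### Two-generator metacyclic presentations -/

/-- If `b` normalizes the powers of `a`, then every element of the group generated by `a` and `b`
has the form `a ^ i * b ^ j`. -/
theorem exists_pow_mul_pow {P : Type*} [Group P] {a b : P} {m s k : ℕ} (hm : m ≠ 0) (hs : s ≠ 0)
    (ha : a ^ m = 1) (hb : b ^ s = 1) (hab : b * a * b⁻¹ = a ^ k)
    (hgen : Subgroup.closure {a, b} = ⊤) (x : P) : ∃ i j : ℕ, x = a ^ i * b ^ j := by
  have hba (i : ℕ) : b * a ^ i = a ^ (k * i) * b := by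
    rw [pow_mul, ← hab, conj_pow]
    group
  have hleft {g : P} (hg : g = a ∨ g = b) {y : P} (hy : ∃ i j : ℕ, y = a ^ i * b ^ j) :
      ∃ i j : ℕ, g * y = a ^ i * b ^ j := by
    obtain ⟨i, j, rfl⟩ := hy
    rcases hg with rfl | rfl
    · exact ⟨i + 1, j, by rw [pow_succ', mul_assoc]⟩
    · exact ⟨k * i, j + 1, by rw [← mul_assoc, hba, pow_succ', mul_assoc]⟩
  have hpow {g : P} (hg : g = a ∨ g = b) (l : ℕ) {y : P} (hy : ∃ i j : ℕ, y = a ^ i * b ^ j) :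
      ∃ i j : ℕ, g ^ l * y = a ^ i * b ^ j := by
    induction l with
    | zero => simpa using hy
    | succ l ih =>
      rw [pow_succ', mul_assoc]
      exact hleft hg ih
  have hinv {g : P} {l : ℕ} (hl : l ≠ 0) (h : g ^ l = 1) : g⁻¹ = g ^ (l - 1) := by
    rw [inv_eq_iff_mul_eq_one, mul_pow_sub_one hl, h]
  have hx : x ∈ Subgroup.closure {a, b} := hgen ▸ Subgroup.mem_top x
  induction hx using Subgroup.closure_induction_left with
  | one => exact ⟨0, 0, by simp⟩
  | mul_left g hg y _ ih => exact hleft hg ih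
  | inv_mul_cancel g hg y _ ih =>
    rcases hg with rfl | rfl
    · rw [hinv hm ha]
      exact hpow (Or.inl rfl) _ ih
    · rw [hinv hs hb]
      exact hpow (Or.inr rfl) _ ih

/-- A homomorphism from such a group to the affine group of `ℤ / m` that sends `a` to the unit
translation and `b` to a homothety of the same order is faithful. -/
theorem injective_of_metacyclic {P : Type*} [Group P] {a b : P} {m s k : ℕ} (hm : m ≠ 0)
    (hs : s ≠ 0) (ha : a ^ m = 1) (hb : b ^ s = 1) (hab : b * a * b⁻¹ = a ^ k)
    (hgen : Subgroup.closure {a, b} = ⊤) (φ : P →* AffineGroup (ZMod m)) {u : (ZMod m)ˣ}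
    (hu : orderOf u = s) (hφa : φ a = ⟨1, 1⟩) (hφb : φ b = ⟨u, 0⟩) : Function.Injective φ := by
  rw [injective_iff_map_eq_one]
  intro x hx
  obtain ⟨i, j, rfl⟩ := exists_pow_mul_pow hm hs ha hb hab hgen x
  rw [map_mul, map_pow, map_pow, hφa, hφb, AffineGroup.translation_pow,
    AffineGroup.homothety_pow, AffineGroup.ext_iff] at hx
  simp only [AffineGroup.scale_mul, AffineGroup.shift_mul, AffineGroup.scale_one,
    AffineGroup.shift_one, one_mul, mul_one, Units.val_one, zero_add] at hx
  obtain ⟨c, rfl⟩ := (ZMod.natCast_eq_zero_iff i m).mp hx.2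
  obtain ⟨d, rfl⟩ := hu ▸ orderOf_dvd_of_pow_eq_one hx.1
  rw [pow_mul, pow_mul, ha, hb, one_pow, one_pow, mul_one]

theorem closure_presentedGroup_of_fin_two (rels : Set (FreeGroup (Fin 2))) :
    Subgroup.closure {PresentedGroup.of (rels := rels) 0, PresentedGroup.of 1} = ⊤ := by
  rw [← PresentedGroup.closure_range_of rels]
  congr 1
  ext x
  simp [Fin.exists_fin_two, eq_comm]

/-! ### Groups with central quotient `Sz(2)` -/

/-- `Sz(2)` is the affine group of `ℤ / 5`; as `b⁻¹ a b = a ^ 2`, the generator `b` acts as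
multiplication by `3 = 2⁻¹`. -/
theorem exists_suzukiTwo_affine :
    ∃ φ : SuzukiTwo →* AffineGroup (ZMod 5), Function.Bijective φ := by
  let u : (ZMod 5)ˣ := ⟨3, 2, by decide, by decide⟩
  have hu : orderOf u = 4 := by
    have h : orderOf u = 2 ^ (1 + 1) := orderOf_eq_prime_pow (by decide) (by decide)
    simpa using h
  let f : Fin 2 → AffineGroup (ZMod 5) := ![⟨1, 1⟩, ⟨u, 0⟩]
  have hf : ∀ r ∈ suzukiTwoRels, FreeGroup.lift f r = 1 := by
    intro r hr
    simp only [suzukiTwoRels, Set.mem_insert_iff, Set.mem_singleton_iff] at hr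
    rcases hr with rfl | rfl | rfl
    · simp only [map_pow, FreeGroup.lift_apply_of, f, Matrix.cons_val_zero,
        AffineGroup.translation_pow]
      ext <;> simp
      decide
    · simp only [map_pow, FreeGroup.lift_apply_of, f, Matrix.cons_val_one,
        Matrix.cons_val_zero, AffineGroup.homothety_pow, ← hu, pow_orderOf_eq_one]
      rfl
    · simp only [map_mul, map_inv, map_pow, FreeGroup.lift_apply_of, f, Matrix.cons_val_zero,
        Matrix.cons_val_one, AffineGroup.translation_pow]
      ext
      · simp
      · simp [u]
        decide
  let φ : SuzukiTwo →* AffineGroup (ZMod 5) := PresentedGroup.toGroup hf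
  set a : SuzukiTwo := PresentedGroup.of 0 with ha
  set b : SuzukiTwo := PresentedGroup.of 1 with hb
  have hφa : φ a = ⟨1, 1⟩ := PresentedGroup.toGroup.of hf
  have hφb : φ b = ⟨u, 0⟩ := PresentedGroup.toGroup.of hf
  have ha5 : a ^ 5 = 1 :=
    PresentedGroup.one_of_mem (rels := suzukiTwoRels) (x := FreeGroup.of 0 ^ 5)
      (by simp [suzukiTwoRels])
  have hb4 : b ^ 4 = 1 :=
    PresentedGroup.one_of_mem (rels := suzukiTwoRels) (x := FreeGroup.of 1 ^ 4)
      (by simp [suzukiTwoRels])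
  have hab : b⁻¹ * a * b = a ^ 2 := mul_inv_eq_one.mp
    (PresentedGroup.one_of_mem (rels := suzukiTwoRels)
      (x := (FreeGroup.of 1)⁻¹ * FreeGroup.of 0 * FreeGroup.of 1 * (FreeGroup.of 0 ^ 2)⁻¹)
      (by simp [suzukiTwoRels]))
  have hba : b * a * b⁻¹ = a ^ 3 := by
    have h1 : b * a ^ 2 * b⁻¹ = a := by
      rw [← hab]
      group
    calc b * a * b⁻¹ = b * (a ^ 2) ^ 3 * b⁻¹ := by
          rw [← pow_mul, show 2 * 3 = 5 + 1 from rfl, pow_succ, ha5, one_mul]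
      _ = a ^ 3 := by rw [← conj_pow, h1]
  have hgen : Subgroup.closure {a, b} = ⊤ := closure_presentedGroup_of_fin_two _
  refine ⟨φ, injective_of_metacyclic (by norm_num) (by norm_num) ha5 hb4 hba hgen φ hu hφa hφb, ?_⟩
  -- The powers of `u` exhaust the four units.
  intro x
  have hpow : ∀ v : (ZMod 5)ˣ, ∃ i : Fin 4, u ^ (i : ℕ) = v := by decide
  obtain ⟨i, hi⟩ := hpow x.scale
  refine ⟨a ^ x.shift.val * b ^ (i : ℕ), ?_⟩
  rw [map_mul, map_pow, map_pow, hφa, hφb, AffineGroup.translation_pow, AffineGroup.homothety_pow]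
  ext <;> simp [hi]

theorem graphEnergy_commutingGraph_of_suzukiTwo_quotient {G : Type*} [Group G] [Finite G]
    (e : G ⧸ Subgroup.center G ≃* SuzukiTwo) :
    graphEnergy (commutingGraph G) = 38 * (Nat.card (Subgroup.center G) : ℝ) - 12 := by
  obtain ⟨φ, hφ⟩ := exists_suzukiTwo_affine
  let ψ : G →* AffineGroup (ZMod 5) :=
    (φ.comp e.toMonoidHom).comp (QuotientGroup.mk' (Subgroup.center G))
  have hinj : Function.Injective (φ.comp e.toMonoidHom) := hφ.1.comp e.injective
  have hsurj : Function.Surjective ψ :=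
    (hφ.2.comp e.surjective).comp (QuotientGroup.mk'_surjective _)
  have hker : ψ.ker = Subgroup.center G := by
    exact (MonoidHom.ker_comp_of_injective _ _ hinj).trans (QuotientGroup.ker_mk' _)
  have : Fact (Nat.Prime 5) := ⟨by norm_num⟩
  rw [graphEnergy_commutingGraph_of_affine_quotient (by norm_num) ψ hsurj hker]
  push_cast
  ring

/-! ### Quasidihedral groups -/

/-- The quasidihedral group of order `2 ^ (r + 4)` is the group of the affine maps of
`ℤ / 2 ^ (r + 3)` whose linear part is `1` or `u = 2 ^ (r + 2) - 1`. -/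
theorem exists_quasidihedral_affine (r : ℕ) :
    ∃ (u : (ZMod (2 ^ (r + 3)))ˣ)
      (φ : QuasidihedralGroup (r + 4) →* AffineGroup (ZMod (2 ^ (r + 3)))),
      (u : ZMod (2 ^ (r + 3))) = 2 ^ (r + 2) - 1 ∧ u ≠ 1 ∧ Function.Injective φ ∧
        ∀ x, x ∈ φ.range ↔ x.scale = 1 ∨ x.scale = u := by
  have hm : (2 : ZMod (2 ^ (r + 3))) ^ (r + 3) = 0 := by
    exact_mod_cast ZMod.natCast_self (2 ^ (r + 3))
  -- The square of `2 ^ (r + 2) - 1` is `1 + (2 ^ (r + 1) - 1) * 2 ^ (r + 3)`.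
  have huu : ((2 : ZMod (2 ^ (r + 3))) ^ (r + 2) - 1) * (2 ^ (r + 2) - 1) = 1 := by
    linear_combination ((2 : ZMod (2 ^ (r + 3))) ^ (r + 1) - 1) * hm
  let u : (ZMod (2 ^ (r + 3)))ˣ := ⟨_, _, huu, huu⟩
  have hu2 : u ^ 2 = 1 := Units.ext (by simpa [pow_two] using huu)
  have hk : ((2 ^ (r + 2) - 1 : ℕ) : ZMod (2 ^ (r + 3))) = u := by
    rw [Nat.cast_sub Nat.one_le_two_pow]
    simp [u]
  have hu1 : u ≠ 1 := by
    intro h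
    have h1 : ((2 ^ (r + 2) - 1 : ℕ) : ZMod (2 ^ (r + 3))) = (1 : ℕ) := by
      rw [hk, h]
      simp
    rw [ZMod.natCast_eq_natCast_iff'] at h1
    have h2 : 4 * 2 ^ r = 2 ^ (r + 2) := by ring
    have h3 : 8 * 2 ^ r = 2 ^ (r + 3) := by ring
    have h4 : 1 ≤ 2 ^ r := Nat.one_le_two_pow
    rw [Nat.mod_eq_of_lt (by omega), Nat.mod_eq_of_lt (by omega)] at h1
    omega
  have hu : orderOf u = 2 := orderOf_eq_prime hu2 hu1
  let f : Fin 2 → AffineGroup (ZMod (2 ^ (r + 3))) := ![⟨1, 1⟩, ⟨u, 0⟩]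
  have hf : ∀ x ∈ quasidihedralRels (r + 4), FreeGroup.lift f x = 1 := by
    intro x hx
    simp only [quasidihedralRels, Set.mem_insert_iff, Set.mem_singleton_iff] at hx
    rcases hx with rfl | rfl | rfl
    · simp only [map_pow, FreeGroup.lift_apply_of, f, Matrix.cons_val_zero,
        AffineGroup.translation_pow]
      ext
      · simp
      · simp
    · simp only [map_pow, FreeGroup.lift_apply_of, f, Matrix.cons_val_one,
        Matrix.cons_val_zero, AffineGroup.homothety_pow, hu2]
      rfl
    · simp only [map_mul, map_inv, map_pow, FreeGroup.lift_apply_of, f, Matrix.cons_val_zero,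
        Matrix.cons_val_one, AffineGroup.translation_pow]
      ext
      · simp
      · have : r + 4 - 2 = r + 2 := rfl
        simp [this, hk]
  let φ : QuasidihedralGroup (r + 4) →* AffineGroup (ZMod (2 ^ (r + 3))) :=
    PresentedGroup.toGroup hf
  set a : QuasidihedralGroup (r + 4) := PresentedGroup.of 0 with ha
  set b : QuasidihedralGroup (r + 4) := PresentedGroup.of 1 with hb
  have hφa : φ a = ⟨1, 1⟩ := PresentedGroup.toGroup.of hf
  have hφb : φ b = ⟨u, 0⟩ := PresentedGroup.toGroup.of hf
  have ham : a ^ (2 ^ (r + 3)) = 1 :=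
    PresentedGroup.one_of_mem (rels := quasidihedralRels (r + 4))
      (x := FreeGroup.of 0 ^ (2 ^ (r + 3))) (by simp [quasidihedralRels])
  have hb2 : b ^ 2 = 1 :=
    PresentedGroup.one_of_mem (rels := quasidihedralRels (r + 4)) (x := FreeGroup.of 1 ^ 2)
      (by simp [quasidihedralRels])
  have hab : b * a * b⁻¹ = a ^ (2 ^ (r + 2) - 1) := mul_inv_eq_one.mp
    (PresentedGroup.one_of_mem (rels := quasidihedralRels (r + 4))
      (x := FreeGroup.of 1 * FreeGroup.of 0 * (FreeGroup.of 1)⁻¹ *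
        (FreeGroup.of 0 ^ (2 ^ (r + 2) - 1))⁻¹) (by simp [quasidihedralRels]))
  have hgen : Subgroup.closure {a, b} = ⊤ := closure_presentedGroup_of_fin_two _
  have hφ (i j : ℕ) : φ (a ^ i * b ^ j) = ⟨u ^ j, i⟩ := by
    rw [map_mul, map_pow, map_pow, hφa, hφb, AffineGroup.translation_pow,
      AffineGroup.homothety_pow]
    ext <;> simp
  refine ⟨u, φ, rfl, hu1, injective_of_metacyclic (by positivity) two_ne_zero ham hb2 hab hgen φ hu
    hφa hφb, fun x => ⟨?_, fun hx => ?_⟩⟩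
  · rintro ⟨y, rfl⟩
    obtain ⟨i, j, rfl⟩ := exists_pow_mul_pow (by positivity) two_ne_zero ham hb2 hab hgen y
    rw [hφ]
    rcases Nat.even_or_odd' j with ⟨c, rfl | rfl⟩
    · left
      simp [pow_mul, hu2]
    · right
      simp [pow_succ, pow_mul, hu2]
  · rcases hx with hx | hx
    · refine ⟨a ^ x.shift.val * b ^ 0, ?_⟩
      rw [hφ]
      ext <;> simp [hx]
    · refine ⟨a ^ x.shift.val * b ^ 1, ?_⟩
      rw [hφ]
      ext <;> simp [hx]

/-- Multiplication by `2 ^ (r + 2) - 2`, that is twice an odd number, kills exactly the elements of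
`ℤ / 2 ^ (r + 3)` that vanish modulo `2 ^ (r + 2)`. -/
theorem two_pow_sub_two_mul_eq_zero_iff (r : ℕ) (t : ZMod (2 ^ (r + 3))) :
    ((2 : ZMod (2 ^ (r + 3))) ^ (r + 2) - 1 - 1) * t = 0 ↔
      ZMod.castHom (pow_dvd_pow 2 (Nat.le_succ (r + 2))) (ZMod (2 ^ (r + 2))) t = 0 := by
  obtain ⟨i, rfl⟩ := ZMod.natCast_zmod_surjective t
  have h1 : (2 : ZMod (2 ^ (r + 3))) ^ (r + 2) - 1 - 1 = ((2 * (2 ^ (r + 1) - 1) : ℕ) : _) := by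
    rw [Nat.cast_mul, Nat.cast_sub Nat.one_le_two_pow]
    push_cast
    ring
  have hcop : Nat.Coprime (2 ^ (r + 2)) (2 ^ (r + 1) - 1) := by
    apply Nat.Coprime.pow_left
    rw [Nat.coprime_two_left]
    exact Nat.Even.sub_odd Nat.one_le_two_pow (by simp [Nat.even_pow]) odd_one
  rw [map_natCast, h1, ← Nat.cast_mul, ZMod.natCast_eq_zero_iff, ZMod.natCast_eq_zero_iff,
    pow_succ', mul_assoc, Nat.mul_dvd_mul_iff_left two_pos, hcop.dvd_mul_left]

/-- The cliques are the rotations `a ^ i` and, for each `t` modulo `2 ^ (n - 2)`, the reflections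
`a ^ i * b` with `i ≡ t`. -/
theorem graphEnergy_commutingGraph_quasidihedral (r : ℕ) :
    graphEnergy (commutingGraph (QuasidihedralGroup (r + 4))) =
      2 * ((2 : ℝ) ^ (r + 4) - 2 - (2 ^ (r + 2) + 1)) := by
  classical
  obtain ⟨u, φ, huv, hu1, hinj, hrange⟩ := exists_quasidihedral_affine r
  have hdvd : 2 ^ (r + 2) ∣ 2 ^ (r + 3) := pow_dvd_pow 2 (Nat.le_succ (r + 2))
  let π := ZMod.castHom hdvd (ZMod (2 ^ (r + 2)))
  have hπ (t : ZMod (2 ^ (r + 3))) : ((u : ZMod (2 ^ (r + 3))) - 1) * t = 0 ↔ π t = 0 := by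
    rw [huv]
    exact two_pow_sub_two_mul_eq_zero_iff r t
  have hscale (x : QuasidihedralGroup (r + 4)) : (φ x).scale = 1 ∨ (φ x).scale = u :=
    (hrange _).mp ⟨x, rfl⟩
  have hcomm (x y : QuasidihedralGroup (r + 4)) : x * y = y * x ↔
      (((φ x).scale : ZMod (2 ^ (r + 3))) - 1) * (φ y).shift =
        ((φ y).scale - 1) * (φ x).shift := by
    rw [← AffineGroup.mul_comm_iff, ← map_mul, ← map_mul, hinj.eq_iff]
  have hcenter (x : QuasidihedralGroup (r + 4)) :
      x ∈ Subgroup.center (QuasidihedralGroup (r + 4)) ↔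
      (φ x).scale = 1 ∧ π (φ x).shift = 0 := by
    rw [Subgroup.mem_center_iff]
    constructor
    · intro h
      obtain ⟨a, ha⟩ := (hrange ⟨1, 1⟩).mpr (Or.inl rfl)
      obtain ⟨b, hb⟩ := (hrange ⟨u, 0⟩).mpr (Or.inr rfl)
      have h1 := (hcomm _ _).mp (h a)
      have h2 := (hcomm _ _).mp (h b)
      rw [ha] at h1
      rw [hb] at h2
      refine ⟨Units.ext (sub_eq_zero.mp (by simpa using h1.symm)), (hπ _).mp ?_⟩
      simpa using h2
    · rintro ⟨h1, h2⟩ y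
      rw [hcomm, h1]
      rcases hscale y with h | h <;> rw [h]
      · simp
      · simpa using (hπ _).mpr h2
  have hcard : Nat.card (QuasidihedralGroup (r + 4)) = 2 ^ (r + 4) := by
    let g : QuasidihedralGroup (r + 4) →
        ({1, u} : Finset (ZMod (2 ^ (r + 3)))ˣ) × ZMod (2 ^ (r + 3)) :=
      fun x => (⟨(φ x).scale, by simpa using hscale x⟩, (φ x).shift)
    have hg : Function.Bijective g := by
      constructor
      · intro x y h
        simp only [g, Prod.mk.injEq, Subtype.mk.injEq] at h
        exact hinj (AffineGroup.ext h.1 h.2)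
      · rintro ⟨⟨v, hv⟩, t⟩
        obtain ⟨x, hx⟩ := (hrange ⟨v, t⟩).mpr (by simpa using hv)
        exact ⟨x, by simp [g, hx]⟩
    rw [Nat.card_congr (Equiv.ofBijective g hg), Nat.card_prod, Nat.card_zmod,
      Nat.card_eq_fintype_card, Fintype.card_coe, Finset.card_pair hu1.symm]
    ring
  have hZ : Nat.card (Subgroup.center (QuasidihedralGroup (r + 4))) = 2 := by
    let g : Subgroup.center (QuasidihedralGroup (r + 4)) → π.toAddMonoidHom.ker :=
      fun x => ⟨(φ x.1).shift, ((hcenter x.1).mp x.2).2⟩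
    have hg : Function.Bijective g := by
      constructor
      · rintro ⟨x, hx⟩ ⟨y, hy⟩ h
        have hs := ((hcenter x).mp hx).1.trans ((hcenter y).mp hy).1.symm
        exact Subtype.ext (hinj (AffineGroup.ext hs (congrArg Subtype.val h)))
      · rintro ⟨t, ht⟩
        obtain ⟨x, hx⟩ := (hrange ⟨1, t⟩).mpr (Or.inl rfl)
        refine ⟨⟨x, (hcenter x).mpr ?_⟩, ?_⟩
        · rw [hx]
          exact ⟨rfl, ht⟩
        · simp [g, hx]
    have hsurj : Function.Surjective π.toAddMonoidHom := ZMod.castHom_surjective hdvd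
    have h := π.toAddMonoidHom.ker.card_mul_index
    rw [AddSubgroup.index_ker, AddMonoidHom.range_eq_top.mpr hsurj, AddSubgroup.card_top,
      Nat.card_zmod, Nat.card_zmod] at h
    rw [Nat.card_congr (Equiv.ofBijective g hg)]
    exact Nat.eq_of_mul_eq_mul_right (by positivity) (h.trans (pow_succ' 2 (r + 2)))
  rw [graphEnergy_commutingGraph
    (ι := Option (ZMod (2 ^ (r + 2))))
    (fun x => if (φ x.1).scale = 1 then none else some (π (φ x.1).shift)), hcard, hZ,
    Finite.card_option, Nat.card_zmod]
  · push_cast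
    ring
  · rintro (_ | t)
    · obtain ⟨x, hx⟩ := (hrange ⟨1, 1⟩).mpr (Or.inl rfl)
      refine ⟨⟨x, fun h => ?_⟩, by simp [hx]⟩
      have := ((hcenter x).mp h).2
      rw [hx, map_one] at this
      have hne : Fact (1 < 2 ^ (r + 2)) := ⟨Nat.one_lt_two_pow (by omega)⟩
      exact one_ne_zero this
    · obtain ⟨s, rfl⟩ : ∃ s, π s = t := ZMod.castHom_surjective hdvd t
      obtain ⟨x, hx⟩ := (hrange ⟨u, s⟩).mpr (Or.inr rfl)
      refine ⟨⟨x, fun h => ?_⟩, by simp [hx, hu1]⟩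
      have := ((hcenter x).mp h).1
      rw [hx] at this
      exact hu1 this
  · rintro ⟨x, hx⟩ ⟨y, hy⟩
    rw [hcenter] at hx hy
    simp only
    rw [hcomm]
    rcases hscale x with h | h <;> rcases hscale y with h' | h' <;> rw [h, h']
    · simp
    · have h1 : π (φ x).shift ≠ 0 := fun h0 => hx ⟨h, h0⟩
      rw [Units.val_one, sub_self, zero_mul, eq_comm, hπ]
      simp [hu1, h1]
    · have h1 : π (φ y).shift ≠ 0 := fun h0 => hy ⟨h', h0⟩
      rw [Units.val_one, sub_self, zero_mul, hπ]
      simp [hu1, h1]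
    · rw [← sub_eq_zero, ← mul_sub, hπ, map_sub, sub_eq_zero]
      simp [hu1, eq_comm]

/-! ### The energies -/

theorem two_lt_two_pow {k : ℕ} (hk : 2 ≤ k) : 2 < 2 ^ k :=
  calc 2 < 2 ^ 2 := by norm_num
    _ ≤ 2 ^ k := Nat.pow_le_pow_right two_pos hk

theorem corollary2p11 :
    -- the quasidihedral group of order `2 ^ n`
    (∀ n : ℕ, 4 ≤ n →
      graphEnergy (commutingGraph (QuasidihedralGroup n)) =
        (2 : ℝ) ^ n + 2 ^ (n - 1) - 6) ∧
    -- the projective special linear group `PSL(2, 2 ^ k)`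
    (∀ (k : ℕ) (F : Type*) [Field F] [Finite F], 2 ≤ k → Nat.card F = 2 ^ k →
      graphEnergy (commutingGraph (Matrix.ProjectiveSpecialLinearGroup (Fin 2) F)) =
        ((2 : ℝ) ^ (3 * k) - 2 ^ (2 * k) - 2 ^ (k + 1) - 2)
          + (2 ^ k - 1) * (2 ^ (k - 1) * (2 ^ k - 1))
          + (2 ^ k - 2) * (2 ^ k + 1)
          + (2 ^ k - 3) * (2 ^ (k - 1) * (2 ^ k + 1))) ∧
    -- the general linear group `GL(2, q)`
    (∀ (p n q : ℕ) (F : Type*) [Field F] [Finite F],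
      p.Prime → q = p ^ n → 2 < q → Nat.card F = q →
      graphEnergy (commutingGraph (Matrix.GeneralLinearGroup (Fin 2) F)) =
        ((q : ℝ) ^ 4 - (q : ℝ) ^ 3 - 2 * (q : ℝ) ^ 2 - q)
          + ((q : ℝ) ^ 2 - 3 * q + 1) * ((q : ℝ) * (q + 1) / 2)
          + ((q : ℝ) ^ 2 - q - 1) * ((q : ℝ) * (q - 1) / 2)
          + ((q : ℝ) ^ 2 - 2 * q) * (q + 1)) ∧
    -- finite groups with `G / Z(G) ≅ Sz(2)`
    (∀ (G : Type*) [Group G] [Finite G],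
      Nonempty (G ⧸ Subgroup.center G ≃* SuzukiTwo) →
      graphEnergy (commutingGraph G) = 38 * (Nat.card (Subgroup.center G) : ℝ) - 12) ∧
    -- the group `A(n, θ)` over `GF(2 ^ n)`, `θ` the Frobenius automorphism
    (∀ (n : ℕ) (F : Type*) [Field F] [Finite F] (θ : F ≃+* F),
      2 ≤ n → Nat.card F = 2 ^ n → (∀ x, θ x = x ^ 2) →
      graphEnergy (commutingGraph (groupATheta θ)) = 2 * ((2 : ℝ) ^ n - 1) ^ 2) ∧
    -- the group `A(n, p)` over `GF(p ^ n)`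
    (∀ (p n : ℕ) (F : Type*) [Field F] [Finite F],
      p.Prime → Nat.card F = p ^ n →
      graphEnergy (commutingGraph (groupAP F)) =
        2 * (p : ℝ) ^ (3 * n) - 4 * (p : ℝ) ^ n - 2) ∧
    -- non-Abelian groups of order `p q`
    (∀ (p q : ℕ) (G : Type*) [Group G] [Finite G],
      p.Prime → q.Prime → p ∣ q - 1 → Nat.card G = p * q →
      (¬ ∀ x y : G, x * y = y * x) →
      graphEnergy (commutingGraph G) = 2 * (q : ℝ) * (p - 1) - 4) := by
  refine ⟨?_, ?_, ?_, ?_, ?_, ?_, ?_⟩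
  · intro n hn
    obtain ⟨r, rfl⟩ := Nat.exists_eq_add_of_le' hn
    rw [graphEnergy_commutingGraph_quasidihedral, show r + 4 - 1 = r + 3 from rfl]
    ring
  · intro k F _ _ hk hF
    have : Fintype F := Fintype.ofFinite F
    have : CharP F 2 := charP_of_card_eq_prime_pow (Nat.card_eq_fintype_card.symm.trans hF)
    have h2 : 2 < Nat.card F := hF ▸ two_lt_two_pow hk
    obtain ⟨l, rfl⟩ := Nat.exists_eq_add_of_le' hk
    rw [graphEnergy_commutingGraph_PSL_two h2, hF, show l + 2 - 1 = l + 1 from rfl]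
    push_cast
    ring
  · rintro p n q F _ _ - - hq rfl
    rw [graphEnergy_commutingGraph_GL_two hq]
    ring
  · rintro G _ _ ⟨e⟩
    exact graphEnergy_commutingGraph_of_suzukiTwo_quotient e
  · intro n F _ _ θ hn hF hθ
    rw [graphEnergy_commutingGraph_groupATheta θ hθ (hF ▸ two_lt_two_pow hn), hF]
    push_cast
    ring
  · intro p n F _ _ _ hF
    rw [graphEnergy_commutingGraph_groupAP, hF]
    push_cast
    ring
  · intro p q G _ _ hp hq hpq hG hna
    exact graphEnergy_commutingGraph_of_card_eq_mul_prime hp hq hpq hG hna
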